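/- Let $\mathbb{T}=\mathbb{R}/\mathbb{Z}$, let $f_c,m\ge 0$ be integers, $n=2f_c+1$, and let $Y\in\mathbb{C}^{n\times m}$, with rows indexed by the integers $l$ with $|l|\le f_c$. For a finite complex measure $x$ on $\mathbb{T}$ put $(\mathcal{F}_n x)_l=\int_{\mathbb{T}}e^{-i2\pi lt}\,x(dt)$ for $|l|\le f_c$, and for $c\in\mathbb{C}^n$ put $(\mathcal{F}_n^{*}c)(t)=\sum_{|l|\le f_c}c_l e^{i2\pi lt}$. For an $m$-tuple $X=(X_1,\dots,X_m)$ of finite complex measures on $\mathbb{T}$, the group total-variation norm is $$\|X\|_{\mathrm{gTV}}=\sup\Big\{\sum_{k=1}^m\operatorname{Re}\int_{\mathbb{T}}\overline{F_k(t)}\,X_k(dt)\;:\;F:\mathbb{T}\to\mathbb{C}^m\text{ continuous},\ \|F(t)\|_2\le 1\text{ for all }t\in\mathbb{T}\Big\}.$$ Consider the primal problem $$\min_{\widetilde X}\ \|\widetilde X\|_{\mathrm{gTV}}\quad\text{subject to}\quad[\mathcal{F}_n\widetilde X_1\ \cdots\ \mathcal{F}_n\widetilde X_m]=Y$$ over all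 $m$-tuples of finite complex measures on $\mathbb{T}$, and its dual $$\max_{C\in\mathbb{C}^{n\times m}}\ \langle Y,C\rangle:=\operatorname{Re}\operatorname{tr}(Y^{*}C)\quad\text{subject to}\quad\sup_{t\in\mathbb{T}}\sum_{k=1}^m|(\mathcal{F}_n^{*}C_k)(t)|^2\le 1,$$ where $C_k$ is the $k$th column of $C$. Lemma. Let $\widehat X$ be a solution of the primal problem of the form $\widehat X_k=\sum_{t_j\in\widehat T}\hat A_{jk}\delta_{t_j}$, $1\le k\le m$, where $\widehat T\subset\mathbb{T}$ is finite and is the support of $\widehat X$ (the set of points all of whose neighbourhoods contain a measurable set $E$ with $\widehat X_k(E)\ne 0$ for some $k$), and $\hat A\in\mathbb{C}^{|\widehat T|\times m}$. Let $\widehat C$ be any solution of the dual problem. Then for every $t_j\in\widehat T$, $$P_{\widehat C}(t_j):=\sum_{k=1}^m|(\mathcal{F}_n^{*}\widehat C_k)(t_j)|^2=1,\qquad\text{and}\qquad(\mathcal{F}_n^{*}\widehat C_k)(t_j)=\frac{\hat A_{jk}}{\|\hat A_{j:}\|_2}\quad(1\le k\le m),$$ where $\hat A_{j:}$ denotes the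 $j$th row of $\hat A$. -/

import Mathlib

open MeasureTheory
open scoped ComplexConjugate

noncomputable section

namespace GroupTV

/-- The frequencies `l` with `|l| ≤ fc`; there are `n = 2 fc + 1` of them. -/
abbrev Freq (fc : ℕ) : Type := ↥(Finset.Icc (-(fc : ℤ)) (fc : ℤ))

/-- A complex measure on a measurable space has finite total variation. Thus every bounded
measurable function is integrable against it, and the integrals below are genuine integrals. -/
theorem isFiniteMeasure_variation {α : Type*} [MeasurableSpace α] (x : ComplexMeasure α) :
    IsFiniteMeasure (VectorMeasure.variation x) := by
  have h : VectorMeasure.variation x ≤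
      (ComplexMeasure.re x).totalVariation + (ComplexMeasure.im x).totalVariation := by
    refine VectorMeasure.variation_le_of_forall_enorm_le fun s _ => ?_
    have h1 := SignedMeasure.enorm_le_totalVariation (ComplexMeasure.re x) s
    have h2 := SignedMeasure.enorm_le_totalVariation (ComplexMeasure.im x) s
    refine le_trans ?_ (add_le_add h1 h2)
    have h3 : ‖x s‖₊ ≤ ‖(x s).re‖₊ + ‖(x s).im‖₊ := by
      have := Complex.norm_le_abs_re_add_abs_im (x s)
      exact_mod_cast this
    change (‖x s‖₊ : ENNReal) ≤ (‖(x s).re‖₊ : ENNReal) + (‖(x s).im‖₊ : ENNReal)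
    exact_mod_cast h3
  have : IsFiniteMeasure ((ComplexMeasure.re x).totalVariation) := by
    unfold SignedMeasure.totalVariation; infer_instance
  have : IsFiniteMeasure ((ComplexMeasure.im x).totalVariation) := by
    unfold SignedMeasure.totalVariation; infer_instance
  exact isFiniteMeasure_of_le _ h

/-- The integral `∫ f(t) x(dt)` of a complex function against a complex measure on the circle. -/
def cintegral (f : UnitAddCircle → ℂ) (x : ComplexMeasure UnitAddCircle) : ℂ :=
  VectorMeasure.integral x f (ContinuousLinearMap.mul ℝ ℂ)

/-- The low-pass Fourier coefficients `(F_n x)_l = ∫ e^{-2πilt} x(dt)`, `|l| ≤ fc`. -/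
def lowPass (fc : ℕ) (x : ComplexMeasure UnitAddCircle) (l : Freq fc) : ℂ :=
  cintegral (fun t => fourier (-(l : ℤ)) t) x

/-- The trigonometric polynomial `(F_n^* c)(t) = ∑_{|l| ≤ fc} c_l e^{2πilt}`. -/
def lowPassAdj (fc : ℕ) (c : Freq fc → ℂ) (t : UnitAddCircle) : ℂ :=
  ∑ l : Freq fc, c l * fourier (l : ℤ) t

/-- The group total-variation norm of an `m`-tuple of complex measures: the supremum of
`∑_k Re ∫ conj (F_k(t)) X_k(dt)` over continuous `F : 𝕋 → ℂ^m` with `‖F(t)‖₂ ≤ 1` for all `t`. -/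
def gTV {m : ℕ} (X : Fin m → ComplexMeasure UnitAddCircle) : EReal :=
  ⨆ (F : C(UnitAddCircle, EuclideanSpace ℂ (Fin m))) (_ : ∀ t, ‖F t‖ ≤ 1),
    ((∑ k, (cintegral (fun t => conj (F t k)) (X k)).re : ℝ) : EReal)

/-- `X` satisfies the data constraint `[F_n X_1 ⋯ F_n X_m] = Y`. -/
def IsPrimalFeasible {fc m : ℕ} (Y : Matrix (Freq fc) (Fin m) ℂ)
    (X : Fin m → ComplexMeasure UnitAddCircle) : Prop :=
  Matrix.of (fun l k => lowPass fc (X k) l) = Y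

/-- `X` is a solution of group-TV minimization with data `Y`. -/
def IsPrimalSolution {fc m : ℕ} (Y : Matrix (Freq fc) (Fin m) ℂ)
    (X : Fin m → ComplexMeasure UnitAddCircle) : Prop :=
  IsPrimalFeasible Y X ∧ ∀ X', IsPrimalFeasible Y X' → gTV X ≤ gTV X'

/-- The support-locating polynomial `P_C(t) = ∑_k |(F_n^* C_k)(t)|²`, `C_k` the columns of `C`. -/
def supportPoly {fc m : ℕ} (C : Matrix (Freq fc) (Fin m) ℂ) (t : UnitAddCircle) : ℝ :=
  ∑ k, ‖lowPassAdj fc (fun l => C l k) t‖ ^ 2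

/-- The real inner product `⟨Y, C⟩ = Re tr (Y^* C)`. -/
def realInner {fc m : ℕ} (Y C : Matrix (Freq fc) (Fin m) ℂ) : ℝ :=
  (Y.conjTranspose * C).trace.re

/-- The constraint `sup_t P_C(t) ≤ 1` of the dual problem. -/
def IsDualFeasible {fc m : ℕ} (C : Matrix (Freq fc) (Fin m) ℂ) : Prop :=
  ∀ t, supportPoly C t ≤ 1

/-- `C` maximizes `⟨Y, C⟩` subject to `sup_t P_C(t) ≤ 1`. -/
def IsDualSolution {fc m : ℕ} (Y C : Matrix (Freq fc) (Fin m) ℂ) : Prop :=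
  IsDualFeasible C ∧ ∀ C', IsDualFeasible C' → realInner Y C' ≤ realInner Y C

/-- The support of the `m`-tuple of measures `X`: the points all of whose neighbourhoods
contain a measurable set that is charged by some `X_k`. -/
def msupport {m : ℕ} (X : Fin m → ComplexMeasure UnitAddCircle) : Set UnitAddCircle :=
  {t | ∀ U ∈ nhds t, ∃ E ⊆ U, MeasurableSet E ∧ ∃ k, X k E ≠ 0}

end GroupTV

end

/-!
The statement is the complementary slackness condition for the group-TV problem.

If `X = ∑ a_j δ_{t_j}` is feasible, the dual objective at `C` is `∑ Re ⟪a_j, q(t_j)⟫`, where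
`q = (F_n^* C_1, …, F_n^* C_m)` (`realInner_eq_of_isPrimalFeasible_atomic`). Dual feasibility of `C`
means `‖q(t)‖ ≤ 1` everywhere, so this is at most `∑ ‖a_j‖`, which is the group-TV norm of `X` when
the `t_j` are distinct (`gTV_atomic_le`, `le_gTV_atomic`). If `X` and `C` are optimal, the absence
of a duality gap (`gTV_le_realInner`) forces equality in the Cauchy–Schwarz inequality at every `t_j`;
hence `a_j = ‖a_j‖ q(t_j)`. Moreover `a_j ≠ 0` because `t_j` lies in the support of `X`.

Strong duality is a finite-dimensional separation argument. The data of the atoms `a δ_t` with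
`‖a‖ ≤ 1` form a compact set, and so does its convex hull. For every `R` larger than the dual value,
the data `Y` lie in `R` times this hull (`vec_mem_smul_convexHull`): otherwise a separating functional
would yield a better dual feasible matrix. Thus `Y` is the data of a finitely supported measure of
norm at most `R`, which bounds the primal value by `R`.
-/

open scoped InnerProductSpace Pointwise

/-! ### Compact convex hulls and equality in Cauchy–Schwarz -/

/-- By Carathéodory's theorem the convex hull is a continuous image of a simplex times a power
of `s`. -/
theorem IsCompact.convexHull_of_finiteDimensional {E : Type*} [NormedAddCommGroup E]
    [NormedSpace ℝ E] [FiniteDimensional ℝ E] {s : Set E} (hs : IsCompact s) :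
    IsCompact (convexHull ℝ s) := by
  obtain rfl | ⟨z₀, hz₀⟩ := s.eq_empty_or_nonempty
  · simp
  let n := Module.finrank ℝ E + 1
  let P : Set ((Fin n → ℝ) × (Fin n → E)) := stdSimplex ℝ (Fin n) ×ˢ Set.univ.pi fun _ => s
  have hP : IsCompact P := (isCompact_stdSimplex ℝ (Fin n)).prod (isCompact_univ_pi fun _ => hs)
  suffices h : convexHull ℝ s = (fun p : (Fin n → ℝ) × (Fin n → E) => ∑ i, p.1 i • p.2 i) '' P by
    rw [h]
    exact hP.image (by fun_prop)
  refine Set.Subset.antisymm (fun x hx => ?_) ?_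
  · obtain ⟨ι, _, z, w, hz, hz', hw, hw1, rfl⟩ := eq_pos_convex_span_of_mem_convexHull hx
    obtain ⟨e⟩ : Nonempty (ι ↪ Fin n) := by
      refine Function.Embedding.nonempty_of_card_le ?_
      rw [Fintype.card_fin]
      exact hz'.card_le_finrank_succ.trans
        (Nat.add_le_add_right (Submodule.finrank_le _) 1)
    -- Pad the convex combination with zero weights to exactly `n` points.
    refine ⟨(Function.extend e w 0, Function.extend e z fun _ => z₀), ⟨⟨fun i => ?_, ?_⟩, ?_⟩, ?_⟩
    · by_cases hi : ∃ a, e a = i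
      · obtain ⟨a, rfl⟩ := hi
        simpa [e.injective.extend_apply] using (hw a).le
      · simp [Function.extend_apply' _ _ _ hi]
    · rw [← hw1]
      refine (Fintype.sum_of_injective e e.injective _ _ (fun i hi => ?_) fun i => ?_).symm
      · exact Function.extend_apply' _ _ _ hi
      · exact (e.injective.extend_apply _ _ _).symm
    · intro i _
      by_cases hi : ∃ a, e a = i
      · obtain ⟨a, rfl⟩ := hi
        simpa [e.injective.extend_apply] using hz ⟨a, rfl⟩
      · simpa [Function.extend_apply' _ _ _ hi] using hz₀
    · refine (Fintype.sum_of_injective e e.injective _ _ (fun i hi => ?_) fun i => ?_).symm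
      · simp [Function.extend_apply' _ _ _ hi]
      · simp [e.injective.extend_apply]
  · rintro _ ⟨⟨w, z⟩, ⟨hw, hz⟩, rfl⟩
    exact mem_convexHull_of_exists_fintype w z hw.1 hw.2 (fun i => hz i trivial) rfl

/-- Equality in the Cauchy–Schwarz inequality for a vector `q` of the unit ball. -/
theorem eq_norm_smul_of_norm_le_re_inner {E : Type*} [NormedAddCommGroup E]
    [InnerProductSpace ℂ E] {a q : E} (hq : ‖q‖ ≤ 1) (h : ‖a‖ ≤ (⟪a, q⟫_ℂ).re) :
    a = (‖a‖ : ℂ) • q := by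
  rw [← sub_eq_zero, ← norm_eq_zero, ← sq_eq_zero_iff]
  refine le_antisymm ?_ (sq_nonneg _)
  have h1 := norm_sub_sq (𝕜 := ℂ) a ((‖a‖ : ℂ) • q)
  have h2 : (⟪a, (‖a‖ : ℂ) • q⟫_ℂ).re = ‖a‖ * (⟪a, q⟫_ℂ).re := by
    rw [inner_smul_right, Complex.re_ofReal_mul]
  have h3 : ‖(‖a‖ : ℂ) • q‖ ≤ ‖a‖ := by
    rw [norm_smul, Complex.norm_real, norm_norm]
    exact mul_le_of_le_one_right (norm_nonneg a) hq
  simp only [RCLike.re_to_complex] at h1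
  rw [h1, h2]
  nlinarith [norm_nonneg a, norm_nonneg ((‖a‖ : ℂ) • q)]

namespace GroupTV

/-! ### Finitely supported measures -/

section Atomic

variable {ι : Type*} [Fintype ι] {m : ℕ}

/-- The `m`-tuple of measures `∑ i, a i δ_{t i}`; the points `t i` need not be distinct. -/
noncomputable def atomic (t : ι → UnitAddCircle) (a : ι → EuclideanSpace ℂ (Fin m)) :
    Fin m → ComplexMeasure UnitAddCircle :=
  fun k => ∑ i, VectorMeasure.dirac (t i) (a i k)

theorem cintegral_atomic (f : UnitAddCircle → ℂ) (t : ι → UnitAddCircle)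
    (a : ι → EuclideanSpace ℂ (Fin m)) (k : Fin m) :
    cintegral f (atomic t a k) = ∑ i, f (t i) * a i k := by
  unfold cintegral atomic
  rw [VectorMeasure.integral_finsetSum_vectorMeasure]
  · simp
  · intro i _
    rw [VectorMeasure.Integrable, VectorMeasure.variation_dirac]
    exact (integrable_dirac (by simp)).smul_measure (by simp)

theorem sum_re_cintegral_atomic (F : UnitAddCircle → EuclideanSpace ℂ (Fin m))
    (t : ι → UnitAddCircle) (a : ι → EuclideanSpace ℂ (Fin m)) :
    ∑ k, (cintegral (fun s => conj (F s k)) (atomic t a k)).re =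
      ∑ i, (⟪F (t i), a i⟫_ℂ).re := by
  simp only [cintegral_atomic, Complex.re_sum, PiLp.inner_apply, RCLike.inner_apply]
  rw [Finset.sum_comm]
  simp only [mul_comm]

theorem gTV_atomic_le (t : ι → UnitAddCircle) (a : ι → EuclideanSpace ℂ (Fin m)) :
    gTV (atomic t a) ≤ ((∑ i, ‖a i‖ : ℝ) : EReal) := by
  refine iSup₂_le fun F hF => ?_
  rw [sum_re_cintegral_atomic, EReal.coe_le_coe_iff]
  refine Finset.sum_le_sum fun i _ => (Complex.re_le_norm _).trans ?_
  exact (norm_inner_le_norm _ _).trans (mul_le_of_le_one_left (norm_nonneg _) (hF _))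

/-- The reverse of `gTV_atomic_le` for distinct atoms: Tietze's theorem provides a continuous
field of vectors in the unit ball with the value `a i / ‖a i‖` at `t i`. -/
theorem le_gTV_atomic {t : ι → UnitAddCircle} (ht : Function.Injective t)
    (a : ι → EuclideanSpace ℂ (Fin m)) :
    ((∑ i, ‖a i‖ : ℝ) : EReal) ≤ gTV (atomic t a) := by
  let _ : TopologicalSpace ι := ⊥
  have : DiscreteTopology ι := ⟨rfl⟩
  have he : Topology.IsClosedEmbedding t :=
    continuous_of_discreteTopology.isClosedEmbedding ht
  let f : C(ι, EuclideanSpace ℂ (Fin m)) :=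
    ⟨fun i => ((‖a i‖ : ℂ)⁻¹) • a i, continuous_of_discreteTopology⟩
  have hf : ∀ i, f i ∈ Metric.closedBall (0 : EuclideanSpace ℂ (Fin m)) 1 := by
    intro i
    rw [mem_closedBall_zero_iff]
    change ‖((‖a i‖ : ℂ)⁻¹) • a i‖ ≤ 1
    rw [norm_smul, norm_inv, Complex.norm_real, norm_norm]
    exact inv_mul_le_one
  have := Metric.instTietzeExtensionClosedBall ℂ (0 : EuclideanSpace ℂ (Fin m)) one_pos
  obtain ⟨F, hF, hFf⟩ := f.exists_extension_forall_mem he hf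
  refine le_iSup₂_of_le F (fun s => mem_closedBall_zero_iff.1 (hF s)) ?_
  rw [sum_re_cintegral_atomic, EReal.coe_le_coe_iff]
  refine Finset.sum_le_sum fun i _ => ?_
  have h1 : F (t i) = ((‖a i‖ : ℂ)⁻¹) • a i := congrArg (fun g => g i) hFf
  have h2 : (⟪a i, a i⟫_ℂ).re = ‖a i‖ ^ 2 := inner_self_eq_norm_sq (𝕜 := ℂ) (a i)
  rw [h1, inner_smul_left, ← Complex.ofReal_inv, Complex.conj_ofReal, Complex.re_ofReal_mul, h2]
  obtain h0 | h0 := eq_or_ne ‖a i‖ 0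
  · simp [h0]
  · refine le_of_eq ?_
    field_simp

theorem ne_zero_of_mem_msupport_atomic {t : ι → UnitAddCircle} (ht : Function.Injective t)
    {a : ι → EuclideanSpace ℂ (Fin m)} {j : ι} (hj : t j ∈ msupport (atomic t a)) :
    a j ≠ 0 := by
  intro h0
  have hfin : (t '' {i | i ≠ j}).Finite := Set.toFinite _
  obtain ⟨E, hE, -, k, hk⟩ := hj (t '' {i | i ≠ j})ᶜ
    (hfin.isClosed.isOpen_compl.mem_nhds fun ⟨i, hi, hij⟩ => hi (ht hij))
  refine hk ?_
  rw [atomic, FunLike.coe_sum, Finset.sum_apply]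
  refine Finset.sum_eq_zero fun i _ => ?_
  obtain rfl | hi := eq_or_ne i j
  · simp [h0]
  · exact VectorMeasure.dirac_apply_of_notMem fun hiE => hE hiE ⟨i, hi, rfl⟩

end Atomic

/-! ### The pairing between data and dual polynomials -/

section Pairing

variable {fc m : ℕ}

/-- A data matrix as a vector of a Euclidean space, whose inner product is `tr (Y^* C)`. -/
noncomputable def vec (Y : Matrix (Freq fc) (Fin m) ℂ) :
    EuclideanSpace ℂ (Freq fc × Fin m) :=
  WithLp.toLp 2 fun p => Y p.1 p.2

/-- The data `e^{-2πilt} a_k` of the single atom `a δ_t`. -/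
noncomputable def atomData (fc : ℕ) (t : UnitAddCircle) (a : EuclideanSpace ℂ (Fin m)) :
    EuclideanSpace ℂ (Freq fc × Fin m) :=
  WithLp.toLp 2 fun p => fourier (-(p.1 : ℤ)) t * a p.2

/-- The vector `((F_n^* C_1)(t), …, (F_n^* C_m)(t))`. -/
noncomputable def dualPoly (C : Matrix (Freq fc) (Fin m) ℂ) (t : UnitAddCircle) :
    EuclideanSpace ℂ (Fin m) :=
  WithLp.toLp 2 fun k => lowPassAdj fc (fun l => C l k) t

theorem supportPoly_eq_norm_sq (C : Matrix (Freq fc) (Fin m) ℂ) (t : UnitAddCircle) :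
    supportPoly C t = ‖dualPoly C t‖ ^ 2 := by
  rw [EuclideanSpace.norm_sq_eq]
  rfl

theorem isDualFeasible_iff {C : Matrix (Freq fc) (Fin m) ℂ} :
    IsDualFeasible C ↔ ∀ t, ‖dualPoly C t‖ ≤ 1 := by
  refine forall_congr' fun t => ?_
  rw [supportPoly_eq_norm_sq, sq_le_one_iff₀ (norm_nonneg _)]

theorem dualPoly_smul (r : ℂ) (C : Matrix (Freq fc) (Fin m) ℂ) (t : UnitAddCircle) :
    dualPoly (r • C) t = r • dualPoly C t := by
  ext k
  simp [dualPoly, lowPassAdj, Finset.mul_sum, mul_assoc]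

theorem realInner_eq (Y C : Matrix (Freq fc) (Fin m) ℂ) :
    realInner Y C = (⟪vec Y, vec C⟫_ℂ).re := by
  simp only [realInner, Matrix.trace, Matrix.diag_apply, Matrix.mul_apply,
    Matrix.conjTranspose_apply, vec, PiLp.inner_apply, RCLike.inner_apply,
    Fintype.sum_prod_type, Complex.star_def]
  rw [Finset.sum_comm]
  simp only [mul_comm]

theorem inner_atomData (t : UnitAddCircle) (a : EuclideanSpace ℂ (Fin m))
    (C : Matrix (Freq fc) (Fin m) ℂ) :
    ⟪atomData fc t a, vec C⟫_ℂ = ⟪a, dualPoly C t⟫_ℂ := by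
  simp only [vec, atomData, dualPoly, lowPassAdj, PiLp.inner_apply, RCLike.inner_apply,
    Fintype.sum_prod_type, map_mul, Finset.sum_mul]
  rw [Finset.sum_comm]
  refine Finset.sum_congr rfl fun k _ => Finset.sum_congr rfl fun l _ => ?_
  rw [fourier_neg, Complex.conj_conj]
  ring

theorem atomData_smul (r : ℝ) (t : UnitAddCircle) (a : EuclideanSpace ℂ (Fin m)) :
    atomData fc t (r • a) = r • atomData fc t a := by
  ext p
  simp [atomData]
  ring

theorem continuous_atomData :
    Continuous fun p : UnitAddCircle × EuclideanSpace ℂ (Fin m) => atomData fc p.1 p.2 := by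
  refine (PiLp.continuous_toLp 2 _).comp (continuous_pi fun p => ?_)
  fun_prop

theorem isPrimalFeasible_atomic_iff {ι : Type*} [Fintype ι] {Y : Matrix (Freq fc) (Fin m) ℂ}
    {t : ι → UnitAddCircle} {a : ι → EuclideanSpace ℂ (Fin m)} :
    IsPrimalFeasible Y (atomic t a) ↔ vec Y = ∑ i, atomData fc (t i) (a i) := by
  have h : ∀ (l : Freq fc) (k : Fin m),
      lowPass fc (atomic t a k) l = (∑ i, atomData fc (t i) (a i)) (l, k) := by
    intro l k
    rw [lowPass, cintegral_atomic]
    simp [atomData]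
  constructor
  · rintro rfl
    ext ⟨l, k⟩
    exact h l k
  · intro hY
    ext l k
    refine (h l k).trans ?_
    rw [← hY]
    rfl

theorem realInner_eq_of_isPrimalFeasible_atomic {ι : Type*} [Fintype ι]
    {Y : Matrix (Freq fc) (Fin m) ℂ} {t : ι → UnitAddCircle}
    {a : ι → EuclideanSpace ℂ (Fin m)} (h : IsPrimalFeasible Y (atomic t a))
    (C : Matrix (Freq fc) (Fin m) ℂ) :
    realInner Y C = ∑ i, (⟪a i, dualPoly C (t i)⟫_ℂ).re := by
  rw [realInner_eq, isPrimalFeasible_atomic_iff.1 h, sum_inner, Complex.re_sum]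
  simp only [inner_atomData]

end Pairing

/-! ### Strong duality -/

section Duality

variable {fc m : ℕ}

/-- The data of all atoms `a δ_t` with `‖a‖ ≤ 1`. -/
def atomSet (fc m : ℕ) : Set (EuclideanSpace ℂ (Freq fc × Fin m)) :=
  (fun p : UnitAddCircle × EuclideanSpace ℂ (Fin m) => atomData fc p.1 p.2) ''
    (Set.univ ×ˢ Metric.closedBall 0 1)

theorem isCompact_atomSet (fc m : ℕ) : IsCompact (atomSet fc m) :=
  (isCompact_univ.prod (isCompact_closedBall _ _)).image continuous_atomData

theorem zero_mem_atomSet (fc m : ℕ) : 0 ∈ atomSet fc m :=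
  ⟨(0, 0), by simp, by ext p; simp [atomData]⟩

theorem realInner_nonneg {Y C : Matrix (Freq fc) (Fin m) ℂ} (hC : IsDualSolution Y C) :
    0 ≤ realInner Y C := by
  have h0 : IsDualFeasible (0 : Matrix (Freq fc) (Fin m) ℂ) := by
    intro t
    simp [supportPoly, lowPassAdj]
  simpa [realInner] using hC.2 0 h0

/-- If the data were outside `R` times the convex hull of the atoms, a separating functional,
rescaled to be dual feasible, would have a dual value of at least `R`. -/
theorem vec_mem_smul_convexHull {Y C : Matrix (Freq fc) (Fin m) ℂ} (hC : IsDualSolution Y C)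
    {R : ℝ} (hR : realInner Y C < R) : vec Y ∈ R • convexHull ℝ (atomSet fc m) := by
  have hR0 : 0 < R := (realInner_nonneg hC).trans_lt hR
  by_contra hY
  have hK : IsCompact (R • convexHull ℝ (atomSet fc m)) :=
    (isCompact_atomSet fc m).convexHull_of_finiteDimensional.smul R
  obtain ⟨f, u, hfu, hu⟩ := RCLike.geometric_hahn_banach_closed_point (𝕜 := ℂ)
    ((convex_convexHull ℝ (atomSet fc m)).smul R) hK.isClosed hY
  -- Riesz representation; conjugating the inner product does not change its real part.
  obtain ⟨D, hD⟩ : ∃ D : Matrix (Freq fc) (Fin m) ℂ, ∀ w, (f w).re = (⟪w, vec D⟫_ℂ).re := by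
    refine ⟨Matrix.of fun l k => (InnerProductSpace.toDual ℂ _).symm f (l, k), fun w => ?_⟩
    rw [← InnerProductSpace.toDual_symm_apply, ← inner_conj_symm, Complex.conj_re]
    rfl
  simp only [RCLike.re_to_complex, hD] at hfu hu
  rw [← realInner_eq] at hu
  have hu0 : 0 < u := by
    have := hfu 0 ⟨0, subset_convexHull ℝ _ (zero_mem_atomSet fc m), by simp⟩
    simpa using this
  have hDu : ∀ t, R * ‖dualPoly D t‖ ≤ u := by
    intro t
    let q := dualPoly D t
    have hq : ‖‖q‖⁻¹ • q‖ ≤ 1 := by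
      rw [norm_smul, norm_inv, norm_norm]
      exact inv_mul_le_one
    have h1 := hfu (R • atomData fc t (‖q‖⁻¹ • q)) ⟨_, subset_convexHull ℝ _
      ⟨(t, ‖q‖⁻¹ • q), by simpa using hq, rfl⟩, rfl⟩
    have h2 : (⟪q, q⟫_ℂ).re = ‖q‖ ^ 2 := inner_self_eq_norm_sq (𝕜 := ℂ) q
    rw [← atomData_smul, smul_smul, inner_atomData, RCLike.real_smul_eq_coe_smul (K := ℂ),
      inner_smul_left, RCLike.conj_ofReal] at h1
    replace h1 : (((R * ‖q‖⁻¹ : ℝ) : ℂ) * ⟪q, q⟫_ℂ).re < u := h1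
    rw [Complex.re_ofReal_mul, h2] at h1
    obtain h0 | h0 := eq_or_ne ‖q‖ 0
    · rw [show ‖dualPoly D t‖ = 0 from h0, mul_zero]
      exact hu0.le
    · rw [sq, mul_assoc, inv_mul_cancel_left₀ h0] at h1
      exact h1.le
  have hfeas : IsDualFeasible (((R / u : ℝ) : ℂ) • D) := by
    rw [isDualFeasible_iff]
    intro t
    rw [dualPoly_smul, norm_smul, Complex.norm_real, Real.norm_of_nonneg (by positivity),
      div_mul_eq_mul_div, div_le_one hu0]
    exact hDu t
  have h1 := hC.2 _ hfeas
  have h2 : realInner Y (((R / u : ℝ) : ℂ) • D) = R / u * realInner Y D := by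
    rw [realInner, Matrix.mul_smul, Matrix.trace_smul, smul_eq_mul, Complex.re_ofReal_mul]
    rfl
  have h3 : R ≤ R / u * realInner Y D := by
    rw [div_mul_eq_mul_div, le_div_iff₀ hu0]
    exact mul_le_mul_of_nonneg_left hu.le hR0.le
  linarith

/-- There is no duality gap: the primal optimal value is at most the dual one. -/
theorem gTV_le_realInner {Y C : Matrix (Freq fc) (Fin m) ℂ}
    {X : Fin m → ComplexMeasure UnitAddCircle} (hX : IsPrimalSolution Y X)
    (hC : IsDualSolution Y C) : gTV X ≤ (realInner Y C : EReal) := by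
  refine EReal.le_of_forall_lt_iff_le.1 fun R hR => ?_
  rw [EReal.coe_lt_coe_iff] at hR
  obtain ⟨v, hv, hvY⟩ := vec_mem_smul_convexHull hC hR
  obtain ⟨ι, _, w, z, hw0, hw1, hz, rfl⟩ := mem_convexHull_iff_exists_fintype.1 hv
  choose p hp hpz using hz
  obtain rfl : z = fun i => atomData fc (p i).1 (p i).2 := funext fun i => (hpz i).symm
  let a : ι → EuclideanSpace ℂ (Fin m) := fun i => (R * w i) • (p i).2
  have hfeas : IsPrimalFeasible Y (atomic (fun i => (p i).1) a) := by
    rw [isPrimalFeasible_atomic_iff, ← hvY]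
    simp only [a, atomData_smul, mul_smul, Finset.smul_sum]
  refine (hX.2 _ hfeas).trans ((gTV_atomic_le _ a).trans ?_)
  rw [EReal.coe_le_coe_iff]
  calc ∑ i, ‖a i‖ ≤ ∑ i, R * w i := by
        refine Finset.sum_le_sum fun i _ => ?_
        have h0 : 0 ≤ R * w i := mul_nonneg (realInner_nonneg hC |>.trans hR.le) (hw0 i)
        rw [norm_smul, Real.norm_of_nonneg h0]
        exact mul_le_of_le_one_right h0 (mem_closedBall_zero_iff.1 (hp i).2)
    _ = R := by rw [← Finset.mul_sum, hw1, mul_one]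

end Duality

end GroupTV

theorem mainTheorem7 {fc m : ℕ} (Y : Matrix (GroupTV.Freq fc) (Fin m) ℂ)
    (X : Fin m → ComplexMeasure UnitAddCircle) (hX : GroupTV.IsPrimalSolution Y X)
    (T : Finset UnitAddCircle) (A : Matrix T (Fin m) ℂ)
    (hXA : ∀ k, X k = ∑ j : T, VectorMeasure.dirac (j : UnitAddCircle) (A j k))
    (hT : (T : Set UnitAddCircle) = GroupTV.msupport X)
    (C : Matrix (GroupTV.Freq fc) (Fin m) ℂ) (hC : GroupTV.IsDualSolution Y C) :
    ∀ j : T, GroupTV.supportPoly C (j : UnitAddCircle) = 1 ∧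
      ∀ k, GroupTV.lowPassAdj fc (fun l => C l k) (j : UnitAddCircle) =
        A j k / (‖WithLp.toLp 2 (A j)‖ : ℂ) := by
  let t : T → UnitAddCircle := Subtype.val
  have ht : Function.Injective t := Subtype.val_injective
  let a : T → EuclideanSpace ℂ (Fin m) := fun j => WithLp.toLp 2 (A j)
  obtain rfl : X = GroupTV.atomic t a := funext hXA
  have hq : ∀ j, ‖GroupTV.dualPoly C (t j)‖ ≤ 1 := fun j =>
    GroupTV.isDualFeasible_iff.1 hC.1 (t j)
  have hle : ∀ j ∈ Finset.univ, (⟪a j, GroupTV.dualPoly C (t j)⟫_ℂ).re ≤ ‖a j‖ := fun j _ =>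
    (Complex.re_le_norm _).trans <| (norm_inner_le_norm _ _).trans <|
      mul_le_of_le_one_right (norm_nonneg _) (hq j)
  have hsum : ∑ j, ‖a j‖ ≤ ∑ j, (⟪a j, GroupTV.dualPoly C (t j)⟫_ℂ).re := by
    rw [← GroupTV.realInner_eq_of_isPrimalFeasible_atomic hX.1, ← EReal.coe_le_coe_iff]
    exact (GroupTV.le_gTV_atomic ht a).trans (GroupTV.gTV_le_realInner hX hC)
  have heq := (Finset.sum_eq_sum_iff_of_le hle).1 (le_antisymm (Finset.sum_le_sum hle) hsum)
  intro j
  have hj : t j ∈ GroupTV.msupport (GroupTV.atomic t a) := hT ▸ j.2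
  have ha : (‖a j‖ : ℂ) ≠ 0 := by
    simpa using GroupTV.ne_zero_of_mem_msupport_atomic ht hj
  have haq := eq_norm_smul_of_norm_le_re_inner (hq j) (heq j (Finset.mem_univ j)).ge
  constructor
  · rw [GroupTV.supportPoly_eq_norm_sq]
    have h1 := congrArg norm haq
    rw [norm_smul, Complex.norm_real, norm_norm] at h1
    have h2 : ‖a j‖ ≠ 0 := by exact_mod_cast ha
    have h3 : ‖GroupTV.dualPoly C (t j)‖ = 1 := mul_left_cancel₀ h2 (by rw [← h1, mul_one])
    change ‖GroupTV.dualPoly C (t j)‖ ^ 2 = 1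
    rw [h3, one_pow]
  · intro k
    rw [eq_div_iff ha, mul_comm]
    exact (congrArg (fun v : EuclideanSpace ℂ (Fin m) => v k) haq).symm
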